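/- **Field content.** Consider a theory whose field species are stable hadrons and flavourless particles (e.g. massive photons). A species $X$ has a mass $m_X>0$ and an integer flavour vector $F_X=(U,D,S,\dots)$ (quarks minus antiquarks of each flavour, so that charge conjugation reverses $F_X$), with integer baryon number $B_X=\frac13\sum_f F_{X,f}$; a flavourless species has a definite C-parity. The species include $\pi^+=u\bar d$, $K^-=s\bar u$, $p=uud$, $\Lambda^0=uds$, $\Xi^0=ssu$, $\Xi^-=ssd$. Assume the following properties of the physical masses: $\pi^\pm$ is the lightest species with $F\ne0$; $K^\pm$ the lightest with $S\neq 0$; $p$ the lightest with odd $B$; $\Lambda^0$ the lightest with $S\ne0$ and odd $B$; $\Xi^0$ the lightest with $S\neq0$ even and $B$ odd; $\Xi^-$ the lightest with $S\ne0$ among the species whose flavour numbers have the same parities as those of $\Xi^-$; moreover $M_{\Xi^-}\le M_p+M_{K^\pm}$, $M_{\Xi^-}\le M_{\Xi^0}+M_{\pi^\pm}$ and $M_p^2+M_{K^\pm}^2\le M_{\Lambda^0}^2$. **Diagrams.** A diagram $\mathcal G$ is a finite multigraph (lines $\ell$ from $i(\ell)$ to $f(\ell)$, looplines allowed) with two distinct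 external vertices $\xi_0,\xi_1$. Each line carries a species, of mass $m_\ell$ and flavour vector $F_\ell$, and at each of its two ends the field of that species or its charge conjugate, with flavour vectors $F(\ell,i)=\pm F_\ell$ and $F(\ell,f)=\pm F_\ell$ (independent signs). The flavour vectors of all line ends at a vertex sum to $0$ at every vertex other than $\xi_0,\xi_1$, and to $\pm F_{\Xi^-}$ at each of $\xi_0$ and $\xi_1$. A line is strange if its species has $S\ne0$. The diagram is in $\mathcal D_s$ if there is a set of vertices containing $\xi_0$ but not $\xi_1$ such that no strange line joins it to its complement. Let $\mathcal G_{s,0}$ be the connected component of $\xi_0$ with respect to strange lines. **Gauge field.** To each line a vector $\vec n_\ell\in\mathbb Z^3$ is assigned; let $\langle\vec n\rangle=\sum_i n_i \bmod 2$. The coefficient $C_\ell(\vec n_\ell)$ is $1$ for a flavourless C-even line, $(-1)^{\langle\vec n_\ell\rangle}$ for a flavourless C-odd line, $\delta_{\langle\vec n_\ell\rangle,0}$ if $F(\ell,i)=-F(\ell,f)\ne0$, and $\delta_{\langle\vec n_\ell\rangle,1}$ if $F(\ell,i)=F(\ell,f)\ne0$. Assume $\prod_\ell C_\ell(\vec n_\ell)\ne0$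 (which holds whenever the Feynman integrand of $(\mathcal G,\vec n)$ is not identically zero). **Time ordering.** Let $\tau$ be a bijection from the vertex set $V(\mathcal G)$ onto $\{1,\dots,|V(\mathcal G)|\}$ with $\tau(a)<\tau(\xi_1)$ for all vertices $a$ of $\mathcal G_{s,0}$. Let $v_-$ be the vertex of $\mathcal G_{s,0}$ with largest $\tau$, $V_-=\{a:\tau(a)\le\tau(v_-)\}$, $L_-$ the set of lines with both endpoints in $V_-$, and $L_0$ the set of lines with exactly one endpoint $a(\ell)$ in $V_-$. For $\ell\in L_0$ let $\vec p_\ell\in\mathbb R^3$ and $E_\ell=\sqrt{m_\ell^2+\vec p_\ell^{\,2}}$. Let $D$ be the set of all $(x(a))_{a\in V_-}$, $x(a)=(x_0(a),\vec x(a))\in\mathbb R^4$, with $x(\xi_0)=0$ and $x_0(a)\le x_0(b)$ whenever $\tau(a)<\tau(b)$. Define, with the Euclidean norm on $\mathbb R^4$, $$\mathcal E_{\mathcal G,\tau}(E,\vec p,\vec n)=\inf_{x\in D}\Big\{-E\,x_0(v_-)+\sum_{\ell\in L_0}E_\ell\,[x_0(v_-)-x_0(a(\ell))]+\sum_{\ell\in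 L_-}m_\ell\,\big|x(f(\ell))-x(i(\ell))+(0,\vec n_\ell)\big|\Big\}.$$ **Theorem.** For every such theory, every $\mathcal G\in\mathcal D_s$, and every $\vec n$, $\tau$, $\vec p$ as above, and every $E$ with $0<E<M_{\Xi^-}$, the set $D$ is non-empty, the functional is bounded below on $D$, and $$\mathcal E_{\mathcal G,\tau}(E,\vec p,\vec n)\ \ge\ \mathcal M(E),$$ where $$\mathcal M(E)=\begin{cases}M_{K^\pm}&\text{if }0<E\le M_p,\\[2pt]\Big[M_{K^\pm}^2-\big(\tfrac{E-M_p}{2}\big)^2\Big]^{1/2}&\text{if }M_p\le E\le\frac{M_{\Lambda^0}^2-M_{K^\pm}^2}{M_p},\\[4pt]\Big[M_{K^\pm}^2-\big(\tfrac{E^2-M_{\Lambda^0}^2+M_{K^\pm}^2}{2E}\big)^2\Big]^{1/2}&\text{if }\frac{M_{\Lambda^0}^2-M_{K^\pm}^2}{M_p}\le E<M_{\Xi^-}.\end{cases}$$ -/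

import Mathlib

noncomputable section

open scoped Classical

namespace FlavourMixing

/-- Flavours: `Sum.inl 0, 1, 2` are up, down, strange; `H` indexes the heavier ones. -/
abbrev Flavour (H : Type*) := Fin 3 ⊕ H

/-- The strange flavour. -/
def strangeQ {H : Type*} : Flavour H := Sum.inl 2

/-- The flavour vector `(U, D, S, 0, 0, …)`. -/
def lightFlavour {H : Type*} (U D S : ℤ) : Flavour H → ℤ :=
  Sum.elim ![U, D, S] 0

/-- Field content of an effective theory of hadrons and (massive) photons: every species is the
field of a stable particle. The flavour numbers count quarks minus antiquarks (so the field and its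
charge conjugate have opposite flavour vectors, and the baryon number is a third of their sum);
`cParity` is meaningful for flavourless fields only. Six species are named. -/
structure Spectrum (H P : Type*) [Fintype H] where
  flavour : P → Flavour H → ℤ
  mass : P → ℝ
  cParity : P → ℤˣ
  mass_pos : ∀ P, 0 < mass P
  three_dvd : ∀ P, (3 : ℤ) ∣ ∑ q, flavour P q
  pion : P
  kaon : P
  proton : P
  lambda : P
  xiZero : P
  xiMinus : P
  /-- `π⁺ = u d̄` -/
  flavour_pion : flavour pion = lightFlavour 1 (-1) 0
  /-- `K⁻ = s ū` -/
  flavour_kaon : flavour kaon = lightFlavour (-1) 0 1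
  /-- `p = uud` -/
  flavour_proton : flavour proton = lightFlavour 2 1 0
  /-- `Λ⁰ = uds` -/
  flavour_lambda : flavour lambda = lightFlavour 1 1 1
  /-- `Ξ⁰ = ssu` -/
  flavour_xiZero : flavour xiZero = lightFlavour 1 0 2
  /-- `Ξ⁻ = ssd` -/
  flavour_xiMinus : flavour xiMinus = lightFlavour 0 1 2

namespace Spectrum

variable {H P : Type*} [Fintype H] (Q : Spectrum H P)

/-- Strangeness, counted as the number of `s` minus the number of `s̄`. -/
def strangeness (X : P) : ℤ := Q.flavour X strangeQ

/-- Baryon number (the division is exact). -/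
def baryonNumber (X : P) : ℤ := (∑ q, Q.flavour X q) / 3

/-- The qualitative properties of the physical masses: which particle is the lightest one with
given quantum numbers, and three inequalities between the masses of the named particles. -/
structure PhysicalMasses : Prop where
  /-- `π^±` is the lightest flavourful particle. -/
  pion_le : ∀ X, Q.flavour X ≠ 0 → Q.mass Q.pion ≤ Q.mass X
  /-- `K^±` is the lightest strange particle. -/
  kaon_le : ∀ X, Q.strangeness X ≠ 0 → Q.mass Q.kaon ≤ Q.mass X
  /-- The proton is the lightest particle with odd baryon number. -/
  proton_le : ∀ X, Odd (Q.baryonNumber X) → Q.mass Q.proton ≤ Q.mass X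
  /-- `Λ⁰` is the lightest strange particle with odd baryon number. -/
  lambda_le : ∀ X, Q.strangeness X ≠ 0 → Odd (Q.baryonNumber X) → Q.mass Q.lambda ≤ Q.mass X
  /-- `Ξ⁰` is the lightest one with odd baryon number and even nonzero strangeness. -/
  xiZero_le : ∀ X, Q.strangeness X ≠ 0 → Even (Q.strangeness X) → Odd (Q.baryonNumber X) →
    Q.mass Q.xiZero ≤ Q.mass X
  /-- `Ξ⁻` is the lightest strange particle whose flavour numbers have the parities of those
  of `Ξ⁻`. -/
  xiMinus_le : ∀ X, Q.strangeness X ≠ 0 →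
    (∀ q, Q.flavour X q ≡ Q.flavour Q.xiMinus q [ZMOD 2]) → Q.mass Q.xiMinus ≤ Q.mass X
  xiMinus_le_proton_kaon : Q.mass Q.xiMinus ≤ Q.mass Q.proton + Q.mass Q.kaon
  xiMinus_le_xiZero_pion : Q.mass Q.xiMinus ≤ Q.mass Q.xiZero + Q.mass Q.pion
  /-- Equivalently `M_p ≤ (M_Λ² - M_K²) / M_p`. -/
  proton_kaon_lambda :
    Q.mass Q.proton ^ 2 + Q.mass Q.kaon ^ 2 ≤ Q.mass Q.lambda ^ 2

end Spectrum

/-- Feynman diagrams (multigraphs, looplines allowed) with vertices `V` and lines `L` for the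
two-point function of the C-even combination of an interpolating operator for `Ξ⁻` and its charge
conjugate. A line is the Wick contraction of two fields of the same species; `srcSign`, `tgtSign`
are `1` for the field and `-1` for its charge conjugate. -/
structure Diagram {H P : Type*} [Fintype H] (Q : Spectrum H P) (V L : Type*) [Fintype L] where
  src : L → V
  tgt : L → V
  species : L → P
  srcSign : L → ℤˣ
  tgtSign : L → ℤˣ
  ξ₀ : V
  ξ₁ : V
  ext_ne : ξ₀ ≠ ξ₁
  /-- Flavour is conserved at the internal vertices. -/
  conserved : ∀ a, a ≠ ξ₀ → a ≠ ξ₁ → ∀ q,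
    (∑ l, ((if src l = a then (srcSign l : ℤ) * Q.flavour (species l) q else 0) +
      (if tgt l = a then (tgtSign l : ℤ) * Q.flavour (species l) q else 0))) = 0
  /-- The operator at an external vertex has the flavour numbers of `Ξ⁻` or of its antiparticle. -/
  external : ∀ a, a = ξ₀ ∨ a = ξ₁ → ∃ σ : ℤˣ, ∀ q,
    (∑ l, ((if src l = a then (srcSign l : ℤ) * Q.flavour (species l) q else 0) +
      (if tgt l = a then (tgtSign l : ℤ) * Q.flavour (species l) q else 0))) =
      (σ : ℤ) * Q.flavour Q.xiMinus q

namespace Diagram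

variable {H P V L : Type*} [Fintype H] [Fintype V] [Fintype L] {Q : Spectrum H P}
  (G : Diagram Q V L)

/-- Flavour vector of the field at the initial point of a line. -/
def srcFlavour (l : L) (q : Flavour H) : ℤ := (G.srcSign l : ℤ) * Q.flavour (G.species l) q

/-- Flavour vector of the field at the final point of a line. -/
def tgtFlavour (l : L) (q : Flavour H) : ℤ := (G.tgtSign l : ℤ) * Q.flavour (G.species l) q

/-- Mass of a line. -/
def lineMass (l : L) : ℝ := Q.mass (G.species l)

/-- Coefficient of the image with winding vector `n` in the finite-volume propagator of `l`, for
C⋆ boundary conditions in all three directions. The four cases: flavourless C-even, flavourless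
C-odd, flavour-preserving, flavour-violating. -/
def coeff (l : L) (n : Fin 3 → ℤ) : ℤ :=
  if Q.flavour (G.species l) = 0 then
    if Q.cParity (G.species l) = 1 then 1 else (((-1 : ℤˣ) ^ (∑ j, n j) : ℤˣ) : ℤ)
  else if G.srcFlavour l = - G.tgtFlavour l then
    if (∑ j, n j) % 2 = 0 then 1 else 0
  else
    if (∑ j, n j) % 2 = 1 then 1 else 0

/-- The product of the coefficients of all lines does not vanish; otherwise the contribution of the
gauge field `n` to the Feynman integrand is identically zero. -/
def Contributes (n : L → Fin 3 → ℤ) : Prop := ∏ l, G.coeff l (n l) ≠ 0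

/-- Strange lines. -/
def IsStrange (l : L) : Prop := G.srcFlavour l strangeQ ≠ 0

/-- The class `D_s`: a cut between the external vertices exists that no strange line crosses. -/
def InDs : Prop :=
  ∃ A : Set V, G.ξ₀ ∈ A ∧ G.ξ₁ ∉ A ∧
    ∀ l, G.IsStrange l → (G.src l ∈ A ↔ G.tgt l ∈ A)

/-- Two vertices are the endpoints of a strange line. -/
def StrangeAdj (a b : V) : Prop :=
  ∃ l, G.IsStrange l ∧ ((G.src l = a ∧ G.tgt l = b) ∨ (G.src l = b ∧ G.tgt l = a))

/-- Vertices of the connected component of `ξ₀` in the subdiagram of strange lines. -/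
def strangeComponent : Finset V :=
  Finset.univ.filter fun a => Relation.ReflTransGen G.StrangeAdj G.ξ₀ a

theorem ext_mem_strangeComponent : G.ξ₀ ∈ G.strangeComponent := by
  simp [strangeComponent, Relation.ReflTransGen.refl]

/-- Time orderings. -/
abbrev TimeOrdering (V : Type*) [Fintype V] := V ≃ Fin (Fintype.card V)

/-- The class `T_s`: `ξ₁` is after all vertices of the strange component of `ξ₀`. -/
def InTs (τ : TimeOrdering V) : Prop := ∀ a ∈ G.strangeComponent, τ a < τ G.ξ₁

/-- The latest vertex `v₋` of the strange component of `ξ₀`. -/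
def lastVertex (τ : TimeOrdering V) : V :=
  τ.symm ((G.strangeComponent.image τ).max' (Finset.image_nonempty.2 ⟨_, G.ext_mem_strangeComponent⟩))

/-- Vertices of the subdiagram `G₋`: those not after `v₋`. -/
abbrev PastVertex (τ : TimeOrdering V) := {a : V // τ a ≤ τ (G.lastVertex τ)}

/-- Lines of `G₋`. -/
abbrev PastLine (τ : TimeOrdering V) :=
  {l : L // τ (G.src l) ≤ τ (G.lastVertex τ) ∧ τ (G.tgt l) ≤ τ (G.lastVertex τ)}

/-- The lines `L₀` with exactly one endpoint in `G₋`. -/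
abbrev CutLine (τ : TimeOrdering V) :=
  {l : L // Xor (τ (G.src l) ≤ τ (G.lastVertex τ)) (τ (G.tgt l) ≤ τ (G.lastVertex τ))}

/-- `v₋` as a vertex of `G₋`. -/
def pastLast (τ : TimeOrdering V) : G.PastVertex τ := ⟨G.lastVertex τ, le_rfl⟩

theorem ext_le_lastVertex (τ : TimeOrdering V) : τ G.ξ₀ ≤ τ (G.lastVertex τ) := by
  simp only [lastVertex, Equiv.apply_symm_apply]
  exact Finset.le_max' _ _ (Finset.mem_image_of_mem _ G.ext_mem_strangeComponent)

/-- `ξ₀` as a vertex of `G₋`. -/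
def pastExt (τ : TimeOrdering V) : G.PastVertex τ := ⟨G.ξ₀, G.ext_le_lastVertex τ⟩

/-- The endpoint in `G₋`, i.e. the earlier one, of a line of `L₀`. -/
def cutInner (τ : TimeOrdering V) (l : G.CutLine τ) : G.PastVertex τ :=
  if h : τ (G.src l.1) ≤ τ (G.lastVertex τ) then ⟨G.src l.1, h⟩
  else ⟨G.tgt l.1, l.2.elim (fun h' => absurd h'.1 h) (fun h' => h'.1)⟩

end Diagram

/-- Euclidean `ℝ⁴`; the coordinate `0` is time. -/
abbrev Spacetime := EuclideanSpace ℝ (Fin 4)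

/-- The vector `(0, n)` of `ℝ⁴`. -/
def windingVec (n : Fin 3 → ℤ) : Spacetime :=
  WithLp.toLp 2 (Fin.cons 0 fun j => (n j : ℝ))

namespace Diagram

variable {H P V L : Type*} [Fintype H] [Fintype V] [Fintype L] {Q : Spectrum H P}
  (G : Diagram Q V L)

/-- Coordinates of the vertices of `G₋`, with `ξ₀` at the origin and times ordered by `τ`. -/
def domain (τ : TimeOrdering V) : Set (G.PastVertex τ → Spacetime) :=
  {x | (∀ a b : G.PastVertex τ, τ a.1 < τ b.1 → x a 0 ≤ x b 0) ∧ x (G.pastExt τ) = 0}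

/-- The functional to be minimized; `p` are the momenta of the lines of `L₀`. -/
def action (τ : TimeOrdering V) (E : ℝ) (p : G.CutLine τ → EuclideanSpace ℝ (Fin 3))
    (n : L → Fin 3 → ℤ) (x : G.PastVertex τ → Spacetime) : ℝ :=
  - E * x (G.pastLast τ) 0
  + ∑ l : G.CutLine τ, √(G.lineMass l.1 ^ 2 + ‖p l‖ ^ 2) *
      (x (G.pastLast τ) 0 - x (G.cutInner τ l) 0)
  + ∑ l : G.PastLine τ, G.lineMass l.1 *
      ‖x ⟨G.tgt l.1, l.2.2⟩ - x ⟨G.src l.1, l.2.1⟩ + windingVec (n l.1)‖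

/-- The decay exponent of the Euclidean kernel: the infimum of the functional. -/
def exponent (τ : TimeOrdering V) (E : ℝ) (p : G.CutLine τ → EuclideanSpace ℝ (Fin 3))
    (n : L → Fin 3 → ℤ) : ℝ :=
  sInf (G.action τ E p n '' G.domain τ)

end Diagram

/-- The lower bound `M(E)`, for `E > 0`. -/
def massBound (MK Mp MΛ E : ℝ) : ℝ :=
  if E ≤ Mp then MK
  else if E ≤ (MΛ ^ 2 - MK ^ 2) / Mp then √(MK ^ 2 - ((E - Mp) / 2) ^ 2)
  else √(MK ^ 2 - ((E ^ 2 - MΛ ^ 2 + MK ^ 2) / (2 * E)) ^ 2)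

end FlavourMixing

end

noncomputable section

open scoped Classical

namespace FlavourMixing

/-! Put `r = massBound MK Mp MΛ E`. The action splits into a temporal part that absorbs `-E *
x₀(v₋)` and a spatial part worth at least `r`. For a line of odd strangeness in the strange
component of `ξ₀`, Cauchy–Schwarz gives `m‖y‖ ≥ √(m² - r²) |y₀| + r |y_j|`; for every other line
`m‖y‖ ≥ m |y₀|` suffices.

Space (`one_le_sum_abs_of_odd_winding`): modulo 2, strangeness conservation makes the
odd-strangeness lines of the component a graph with even degrees. The component contains `ξ₀` but
not `ξ₁`, so strangeness `±2` must be absorbed by flavour-violating lines. Hence an odd number of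
the odd-strangeness lines violate flavour, and the total winding of these lines is odd in some
direction `j`. Their total length along `j` is then at least 1.

Time (`mul_le_sum_weight_mul_length`): each time in `(0, x₀(v₋)]` defines a cut separating `ξ₀` from
`v₋` and `ξ₁`. Parity of flavour and connectedness of the strange component force the crossing lines
to have reduced masses at least those of Λ and K, or of K, K and p, or to have total mass at least
that of Ξ⁻ without any reduction (`le_sum_reducedMass_crossing`). The value of `r` is chosen so that
each of these sums is at least `E`. -/

/-! ### Lengths on the circle and on the time axis -/

theorem intervalIntegral_fract (a : ℝ) : ∫ θ in (0 : ℝ)..1, Int.fract (a - θ) = 1 / 2 := by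
  rw [intervalIntegral.integral_comp_sub_left (fun x => Int.fract x) a]
  have h := (show Function.Periodic (Int.fract : ℝ → ℝ) 1 from Int.fract_periodic ℝ
    ).intervalIntegral_add_eq (a - 1) 0
  simp only [sub_add_cancel, zero_add] at h
  rw [sub_zero, h]
  have : ∫ x in (0 : ℝ)..1, Int.fract x = ∫ x in (0 : ℝ)..1, x := by
    apply intervalIntegral.integral_congr_Ioo_of_le zero_le_one
    intro x hx
    exact Int.fract_eq_self.2 ⟨hx.1.le, hx.2⟩
  rw [this, integral_id]
  norm_num

theorem intervalIntegrable_floor_sub (a : ℝ) :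
    IntervalIntegrable (fun θ : ℝ => (⌊a - θ⌋ : ℝ)) MeasureTheory.volume 0 1 := by
  apply Antitone.intervalIntegrable
  intro x y hxy
  exact Int.cast_le.2 (Int.floor_le_floor (by linarith))

theorem intervalIntegral_floor_sub (a : ℝ) : ∫ θ in (0 : ℝ)..1, (⌊a - θ⌋ : ℝ) = a - 1 := by
  have hi : IntervalIntegrable (fun θ : ℝ => a - θ) MeasureTheory.volume 0 1 :=
    (by fun_prop : Continuous fun θ : ℝ => a - θ).intervalIntegrable _ _
  have h : ∫ θ in (0 : ℝ)..1, Int.fract (a - θ) =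
      (∫ θ in (0 : ℝ)..1, (a - θ)) - ∫ θ in (0 : ℝ)..1, (⌊a - θ⌋ : ℝ) :=
    intervalIntegral.integral_sub hi (intervalIntegrable_floor_sub a)
  rw [intervalIntegral_fract, intervalIntegral.integral_sub (by simp) (by simp)] at h
  simp only [intervalIntegral.integral_const, integral_id] at h
  norm_num at h
  linarith

/-- Averaged over shifts of the lattice, the number of lattice points between two reals is their
distance. -/
theorem intervalIntegral_abs_floor_sub (a b : ℝ) :
    ∫ θ in (0 : ℝ)..1, |(⌊b - θ⌋ : ℝ) - ⌊a - θ⌋| = |b - a| := by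
  wlog hab : a ≤ b generalizing a b
  · rw [abs_sub_comm b a, ← this b a (le_of_not_ge hab)]
    simp only [abs_sub_comm]
  have : ∀ θ : ℝ, |(⌊b - θ⌋ : ℝ) - ⌊a - θ⌋| = (⌊b - θ⌋ : ℝ) - ⌊a - θ⌋ := fun θ =>
    abs_of_nonneg (sub_nonneg.2 (by exact_mod_cast Int.floor_le_floor (by linarith)))
  simp only [this]
  rw [intervalIntegral.integral_sub (intervalIntegrable_floor_sub b)
    (intervalIntegrable_floor_sub a), intervalIntegral_floor_sub, intervalIntegral_floor_sub,
    abs_of_nonneg (by linarith)]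
  ring

/-- In a multigraph all of whose degrees are even, mapped to the circle with odd total winding, the
total length is at least one. -/
theorem one_le_sum_abs_of_odd_winding {V L : Type*} (C : Finset L) (src tgt : L → V)
    (even : ∀ g : V → ℤ, Even (∑ l ∈ C, (g (src l) + g (tgt l))))
    (n : L → ℤ) (odd : Odd (∑ l ∈ C, n l)) (s : V → ℝ) :
    1 ≤ ∑ l ∈ C, |s (tgt l) - s (src l) + n l| := by
  have hint : ∀ l : L, IntervalIntegrable
      (fun θ : ℝ => |(⌊s (tgt l) + n l - θ⌋ : ℝ) - ⌊s (src l) - θ⌋|) MeasureTheory.volume 0 1 :=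
    fun l => ((intervalIntegrable_floor_sub _).sub (intervalIntegrable_floor_sub _)).abs
  -- Modulo 2, each term is the sum of the floors at both ends plus `n l`. The floors cancel because
  -- all degrees are even, so the sum is an odd nonnegative integer.
  have key : ∀ θ : ℝ, 1 ≤ ∑ l ∈ C, |(⌊s (tgt l) + n l - θ⌋ : ℝ) - ⌊s (src l) - θ⌋| := by
    intro θ
    have hodd : Odd (∑ l ∈ C, |⌊s (tgt l) + n l - θ⌋ - ⌊s (src l) - θ⌋|) := by
      have h1 := (even fun a => ⌊s a - θ⌋).add_odd odd
      rw [← Finset.sum_add_distrib] at h1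
      rw [← Int.not_even_iff_odd] at h1 ⊢
      rw [even_iff_two_dvd, Int.dvd_iff_emod_eq_zero] at h1 ⊢
      rw [Finset.sum_int_mod] at h1 ⊢
      rwa [Finset.sum_congr rfl fun l _ => ?_]
      have : s (tgt l) + n l - θ = s (tgt l) - θ + n l := by ring
      rw [this, Int.floor_add_intCast]
      rcases abs_cases (⌊s (tgt l) - θ⌋ + n l - ⌊s (src l) - θ⌋) with h | h <;> omega
    have hpos : 0 ≤ ∑ l ∈ C, |⌊s (tgt l) + n l - θ⌋ - ⌊s (src l) - θ⌋| :=
      Finset.sum_nonneg fun l _ => abs_nonneg _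
    obtain ⟨k, hk⟩ := hodd
    have : 1 ≤ ∑ l ∈ C, |⌊s (tgt l) + n l - θ⌋ - ⌊s (src l) - θ⌋| := by omega
    exact_mod_cast this
  have h := intervalIntegral.integral_mono_on (μ := MeasureTheory.volume) zero_le_one
    (intervalIntegrable_const (c := (1 : ℝ)))
    (IntervalIntegrable.sum C fun l _ => hint l) (fun θ _ => by simpa using key θ)
  rw [intervalIntegral.integral_const] at h
  simp only [Finset.sum_apply] at h
  rw [intervalIntegral.integral_finsetSum (fun l _ => hint l)] at h
  simp only [intervalIntegral_abs_floor_sub] at h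
  have e : ∀ l, s (tgt l) - s (src l) + n l = s (tgt l) + n l - s (src l) := fun l => by ring
  simp only [e]
  simpa using h

/-- If the intervals that contain a time have total weight at least `E`, for every time up to `T`,
then the weighted total length is at least `E * T`. -/
theorem mul_le_sum_weight_mul_length {L : Type*} [Fintype L] (w s t : L → ℝ) (hw : ∀ l, 0 ≤ w l)
    {E T : ℝ} (hT : 0 ≤ T)
    (h : ∀ r ∈ Set.Ioc 0 T, E ≤ ∑ l, if r ∈ Set.uIoc (s l) (t l) then w l else 0) :
    E * T ≤ ∑ l, w l * |t l - s l| := by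
  have hi : ∀ l, MeasureTheory.Integrable
      (fun r => if r ∈ Set.uIoc (s l) (t l) then w l else 0) MeasureTheory.volume := by
    intro l
    have : MeasureTheory.Integrable ((Set.uIoc (s l) (t l)).indicator fun _ => w l)
        MeasureTheory.volume :=
      (MeasureTheory.integrable_indicator_iff measurableSet_uIoc).2 (by simp)
    exact this.congr (.of_forall fun r => by simp [Set.indicator_apply])
  have hv : ∀ l, ∫ r, (if r ∈ Set.uIoc (s l) (t l) then w l else 0) = w l * |t l - s l| := by
    intro l
    have : ∫ r, (Set.uIoc (s l) (t l)).indicator (fun _ => w l) r = w l * |t l - s l| := by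
      rw [MeasureTheory.integral_indicator measurableSet_uIoc]
      simp [MeasureTheory.measureReal_def, mul_comm]
    rw [← this]
    simp only [Set.indicator_apply]
  calc E * T = ∫ r in Set.Ioc 0 T, E := by simp [hT, mul_comm]
    _ ≤ ∫ r in Set.Ioc 0 T, ∑ l, (if r ∈ Set.uIoc (s l) (t l) then w l else 0) :=
        MeasureTheory.setIntegral_mono_on (by simp)
          (MeasureTheory.integrable_finsetSum _ fun l _ => hi l).integrableOn measurableSet_Ioc h
    _ ≤ ∫ r, ∑ l, (if r ∈ Set.uIoc (s l) (t l) then w l else 0) :=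
        MeasureTheory.setIntegral_le_integral
          (MeasureTheory.integrable_finsetSum _ fun l _ => hi l)
          (.of_forall fun r => Finset.sum_nonneg fun l _ => by
            split_ifs <;> simp [hw l])
    _ = ∑ l, w l * |t l - s l| := by
        rw [MeasureTheory.integral_finsetSum _ fun l _ => hi l]
        simp only [hv]

/-! ### Calibration and the choice of the bound -/

/-- A calibration bound: the length of a spacetime vector, weighted with a mass, controls its
temporal and one of its spatial coordinates. -/
theorem calibration_le_mul_norm {m q : ℝ} (hq : 0 ≤ q) (hqm : q ≤ m) (y : Spacetime) (j : Fin 3) :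
    √(m ^ 2 - q ^ 2) * |y 0| + q * |y j.succ| ≤ m * ‖y‖ := by
  have hs : √(m ^ 2 - q ^ 2) ^ 2 = m ^ 2 - q ^ 2 := Real.sq_sqrt (by nlinarith)
  have hy : |y 0| ^ 2 + |y j.succ| ^ 2 ≤ ‖y‖ ^ 2 := by
    rw [EuclideanSpace.norm_sq_eq, Fin.sum_univ_succ]
    simp only [Real.norm_eq_abs]
    gcongr
    exact Finset.single_le_sum (f := fun i : Fin 3 => |y i.succ| ^ 2)
      (fun i _ => by positivity) (Finset.mem_univ j)
  refine abs_le_of_sq_le_sq' ?_ (by positivity [hq.trans hqm]) |>.2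
  rw [mul_pow]
  -- Lagrange's identity: the last square is the defect in Cauchy–Schwarz.
  nlinarith [mul_le_mul_of_nonneg_left hy (sq_nonneg m),
    sq_nonneg (√(m ^ 2 - q ^ 2) * |y j.succ| - q * |y 0|)]

/-- The properties of `q = massBound MK Mp MΛ E` for which it bounds the exponent. -/
theorem massBound_spec {MK Mp ML E : ℝ} (hK : 0 < MK) (hp : 0 < Mp) (hL : 0 < ML) (hE : 0 < E)
    (hE' : E ≤ Mp + MK) (h : Mp ^ 2 + MK ^ 2 ≤ ML ^ 2) :
    0 ≤ massBound MK Mp ML E ∧ massBound MK Mp ML E ≤ MK ∧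
    E ≤ √(ML ^ 2 - massBound MK Mp ML E ^ 2) + √(MK ^ 2 - massBound MK Mp ML E ^ 2) ∧
    E ≤ 2 * √(MK ^ 2 - massBound MK Mp ML E ^ 2) + Mp := by
  -- Here `e` is the reduced kaon mass `√(MK² - q²)`. The three regimes take `e` to be 0, then the
  -- value saturating `E ≤ 2 * e + Mp`, then the value saturating the Λ–K condition.
  have general : ∀ e : ℝ, 0 ≤ e → e ≤ MK → E - e ≤ √(ML ^ 2 - MK ^ 2 + e ^ 2) →
      E ≤ 2 * e + Mp →
      0 ≤ √(MK ^ 2 - e ^ 2) ∧ √(MK ^ 2 - e ^ 2) ≤ MK ∧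
      E ≤ √(ML ^ 2 - √(MK ^ 2 - e ^ 2) ^ 2) + √(MK ^ 2 - √(MK ^ 2 - e ^ 2) ^ 2) ∧
      E ≤ 2 * √(MK ^ 2 - √(MK ^ 2 - e ^ 2) ^ 2) + Mp := by
    intro e he heK h1 h2
    have hs : √(MK ^ 2 - e ^ 2) ^ 2 = MK ^ 2 - e ^ 2 := Real.sq_sqrt (by nlinarith)
    have h3 : √(MK ^ 2 - √(MK ^ 2 - e ^ 2) ^ 2) = e := by
      rw [hs, sub_sub_cancel, Real.sqrt_sq he]
    refine ⟨Real.sqrt_nonneg _, Real.sqrt_le_iff.2 ⟨hK.le, by nlinarith⟩, ?_, ?_⟩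
    · rw [h3, hs, show ML ^ 2 - (MK ^ 2 - e ^ 2) = ML ^ 2 - MK ^ 2 + e ^ 2 by ring]
      linarith
    · rw [h3]; exact h2
  unfold massBound
  split_ifs with h1 h2
  · have := general 0 le_rfl hK.le (Real.le_sqrt_of_sq_le (by nlinarith)) (by linarith)
    simpa [Real.sqrt_sq hK.le] using this
  · push Not at h1
    rw [le_div_iff₀ hp] at h2
    exact general _ (by linarith) (by linarith) (Real.le_sqrt_of_sq_le (by nlinarith))
      (by linarith)
  · push Not at h1 h2
    rw [div_lt_iff₀ hp] at h2
    have hpL : Mp ≤ ML := by nlinarith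
    have hKL : MK ≤ ML := by nlinarith
    have he : (E ^ 2 - ML ^ 2 + MK ^ 2) / (2 * E) * (2 * E) = E ^ 2 - ML ^ 2 + MK ^ 2 :=
      div_mul_cancel₀ _ (by positivity)
    -- Solution of `(E - e)² = ML² - MK² + e²`. The bound `e ≤ MK` amounts to `(E - MK)² ≤ ML²`.
    set e := (E ^ 2 - ML ^ 2 + MK ^ 2) / (2 * E)
    refine general e (div_nonneg (by nlinarith) (by positivity)) ?_ ?_ ?_
    · rw [div_le_iff₀ (by positivity)]
      nlinarith [mul_nonneg (show 0 ≤ ML + MK - E by linarith) (show 0 ≤ ML - MK + E by linarith)]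
    · exact Real.le_sqrt_of_sq_le (by nlinarith)
    · nlinarith

/-! ### Parities of flavour, strange component, winding and cuts -/

theorem Spectrum.odd_baryonNumber_iff {H P : Type*} [Fintype H] (Q : Spectrum H P) (X : P) :
    Odd (Q.baryonNumber X) ↔ Odd (∑ q, Q.flavour X q) := by
  obtain ⟨k, hk⟩ := Q.three_dvd X
  rw [Spectrum.baryonNumber, hk, Int.mul_ediv_cancel_left _ (by norm_num), Int.odd_mul]
  simp [show Odd (3 : ℤ) by decide]

theorem Spectrum.strangeness_xiMinus {H P : Type*} [Fintype H] (Q : Spectrum H P) :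
    Q.flavour Q.xiMinus strangeQ = 2 := by
  simp [Q.flavour_xiMinus, lightFlavour, strangeQ]

theorem Spectrum.odd_sum_flavour_xiMinus {H P : Type*} [Fintype H] (Q : Spectrum H P) :
    Odd (∑ q, Q.flavour Q.xiMinus q) := by
  simp [Q.flavour_xiMinus, lightFlavour, Fin.sum_univ_three]
  decide

namespace Diagram

variable {H P V L : Type*} [Fintype H] [Fintype L] {Q : Spectrum H P} (G : Diagram Q V L)

theorem isStrange_iff {l : L} : G.IsStrange l ↔ Q.strangeness (G.species l) ≠ 0 := by
  simp [IsStrange, srcFlavour, Spectrum.strangeness]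

/-- Lines with exactly one endpoint in a set of vertices. -/
def crossing (A : Set V) : Finset L :=
  Finset.univ.filter fun l => ¬(G.src l ∈ A ↔ G.tgt l ∈ A)

theorem mem_crossing {A : Set V} {l : L} :
    l ∈ G.crossing A ↔ ¬(G.src l ∈ A ↔ G.tgt l ∈ A) := by
  simp [crossing]

variable [Fintype V]

/-- Flavour conservation, summed against a weight of the vertices. -/
theorem exists_sum_flavour_eq (q : Flavour H) : ∃ σ₀ σ₁ : ℤˣ, ∀ g : V → ℤ,
    ∑ l, ((G.srcSign l : ℤ) * g (G.src l) + (G.tgtSign l : ℤ) * g (G.tgt l)) *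
      Q.flavour (G.species l) q =
    (g G.ξ₀ * σ₀ + g G.ξ₁ * σ₁) * Q.flavour Q.xiMinus q := by
  obtain ⟨σ₀, h₀⟩ := G.external G.ξ₀ (.inl rfl)
  obtain ⟨σ₁, h₁⟩ := G.external G.ξ₁ (.inr rfl)
  refine ⟨σ₀, σ₁, fun g => ?_⟩
  set c : V → ℤ := fun a => ∑ l,
    ((if G.src l = a then (G.srcSign l : ℤ) * Q.flavour (G.species l) q else 0) +
      (if G.tgt l = a then (G.tgtSign l : ℤ) * Q.flavour (G.species l) q else 0)) with hc
  have hsum : ∑ l, ((G.srcSign l : ℤ) * g (G.src l) + (G.tgtSign l : ℤ) * g (G.tgt l)) *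
      Q.flavour (G.species l) q = ∑ a, g a * c a := by
    simp only [hc, Finset.mul_sum]
    rw [Finset.sum_comm]
    refine Finset.sum_congr rfl fun l _ => ?_
    simp only [mul_add, mul_ite, mul_zero, Finset.sum_add_distrib, Finset.sum_ite_eq,
      Finset.mem_univ, if_true]
    ring
  rw [hsum, ← Finset.sum_subset (Finset.subset_univ {G.ξ₀, G.ξ₁}) fun a _ ha => ?_,
    Finset.sum_pair G.ext_ne]
  · simp only [hc, h₀ q, h₁ q]
    ring
  · simp only [Finset.mem_insert, Finset.mem_singleton, not_or] at ha
    simp only [hc, G.conserved a ha.1 ha.2 q, mul_zero]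

theorem mem_strangeComponent {a : V} :
    a ∈ G.strangeComponent ↔ Relation.ReflTransGen G.StrangeAdj G.ξ₀ a := by
  simp [strangeComponent]

theorem src_mem_strangeComponent_iff {l : L} (hl : G.IsStrange l) :
    G.src l ∈ G.strangeComponent ↔ G.tgt l ∈ G.strangeComponent := by
  simp only [mem_strangeComponent]
  exact ⟨fun h => h.tail ⟨l, hl, .inl ⟨rfl, rfl⟩⟩, fun h => h.tail ⟨l, hl, .inr ⟨rfl, rfl⟩⟩⟩

theorem ext_notMem_strangeComponent (hG : G.InDs) : G.ξ₁ ∉ G.strangeComponent := by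
  obtain ⟨A, h₀, h₁, hA⟩ := hG
  rw [mem_strangeComponent]
  intro h
  refine h₁ ?_
  generalize G.ξ₁ = b at h
  induction h with
  | refl => exact h₀
  | tail _ hbc ih =>
    obtain ⟨l, hl, ⟨rfl, rfl⟩ | ⟨rfl, rfl⟩⟩ := hbc
    · exact (hA l hl).1 ih
    · exact (hA l hl).2 ih

/-- The lines with odd strangeness in the strange component of `ξ₀`. -/
def oddStrange : Finset L :=
  Finset.univ.filter fun l => Odd (Q.strangeness (G.species l)) ∧ G.src l ∈ G.strangeComponent

theorem mem_oddStrange {l : L} : l ∈ G.oddStrange ↔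
    Odd (Q.strangeness (G.species l)) ∧ G.src l ∈ G.strangeComponent := by
  simp [oddStrange]

theorem isStrange_of_mem_oddStrange {l : L} (hl : l ∈ G.oddStrange) : G.IsStrange l := by
  rw [isStrange_iff]
  intro h
  simpa [h] using (G.mem_oddStrange.1 hl).1

theorem tgt_mem_of_mem_oddStrange {l : L} (hl : l ∈ G.oddStrange) :
    G.tgt l ∈ G.strangeComponent :=
  (G.src_mem_strangeComponent_iff (G.isStrange_of_mem_oddStrange hl)).1 (G.mem_oddStrange.1 hl).2

/-- Conservation of strangeness within the strange component of `ξ₀`. -/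
theorem exists_sum_strangeness_eq (hG : G.InDs) : ∃ σ : ℤˣ, ∀ g : V → ℤ,
    ∑ l, (if G.src l ∈ G.strangeComponent then
      ((G.srcSign l : ℤ) * g (G.src l) + (G.tgtSign l : ℤ) * g (G.tgt l)) *
        Q.strangeness (G.species l) else 0) = g G.ξ₀ * σ * 2 := by
  obtain ⟨σ, σ', h⟩ := G.exists_sum_flavour_eq strangeQ
  refine ⟨σ, fun g => ?_⟩
  -- Cutting the weight off outside the component removes the term of `ξ₁`; it splits no strange
  -- line.
  have := h fun a => if a ∈ G.strangeComponent then g a else 0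
  rw [if_pos G.ext_mem_strangeComponent, if_neg (G.ext_notMem_strangeComponent hG),
    Q.strangeness_xiMinus, zero_mul, add_zero] at this
  rw [← this]
  refine Finset.sum_congr rfl fun l _ => ?_
  by_cases hl : G.IsStrange l
  · simp only [← G.src_mem_strangeComponent_iff hl]
    split_ifs <;> simp [Spectrum.strangeness]
  · rw [isStrange_iff, not_not] at hl
    rw [hl, show Q.flavour (G.species l) strangeQ = 0 from hl]
    simp

/-- Modulo 2 the signs in the conservation law disappear, lines of even strangeness drop out, and
the source at `ξ₀`, of strangeness `±2`, vanishes: the odd-strangeness lines form a cycle with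
coefficients in `ℤ/2`. -/
theorem even_sum_oddStrange (hG : G.InDs) (g : V → ℤ) :
    Even (∑ l ∈ G.oddStrange, (g (G.src l) + g (G.tgt l))) := by
  obtain ⟨σ, h⟩ := G.exists_sum_strangeness_eq hG
  have hd : (2 : ℤ) ∣ ∑ l, ((if l ∈ G.oddStrange then g (G.src l) + g (G.tgt l) else 0) -
      if G.src l ∈ G.strangeComponent then
        ((G.srcSign l : ℤ) * g (G.src l) + (G.tgtSign l : ℤ) * g (G.tgt l)) *
          Q.strangeness (G.species l) else 0) := by
    refine Finset.dvd_sum fun l _ => ?_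
    simp only [mem_oddStrange]
    by_cases hl : G.src l ∈ G.strangeComponent
    · rcases Int.even_or_odd' (Q.strangeness (G.species l)) with ⟨k, hk | hk⟩
      · simp only [hl, hk, Int.not_odd_iff_even.2 (even_two_mul k), if_false, if_true, false_and]
        exact (dvd_zero _).sub ((dvd_mul_right 2 k).mul_left _)
      · rw [if_pos ⟨⟨k, hk⟩, hl⟩, if_pos hl, hk, mul_add, mul_left_comm, mul_one, ← sub_sub,
          sub_right_comm]
        refine dvd_sub ?_ (dvd_mul_right _ _)
        rcases Int.units_eq_one_or (G.srcSign l) with h1 | h1 <;>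
        rcases Int.units_eq_one_or (G.tgtSign l) with h2 | h2 <;>
        simp only [h1, h2, Units.val_neg, Units.val_one] <;> omega
    · simp [hl]
  rw [Finset.sum_sub_distrib, h g, Finset.sum_ite_mem, Finset.univ_inter] at hd
  rw [even_iff_two_dvd]
  exact (dvd_sub_left (dvd_mul_left _ _)).1 hd

/-- A contributing gauge field winds an odd number of times around the odd-strangeness lines
of the component of `ξ₀`. -/
theorem odd_sum_winding (hG : G.InDs) {n : L → Fin 3 → ℤ} (hn : G.Contributes n) :
    Odd (∑ l ∈ G.oddStrange, ∑ j, n l j) := by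
  obtain ⟨σ, h⟩ := G.exists_sum_strangeness_eq hG
  have hc : ∀ l, G.coeff l (n l) ≠ 0 := fun l => Finset.prod_ne_zero_iff.1 hn l (Finset.mem_univ l)
  -- Conservation with weight 1, modulo 4: flavour-preserving lines contribute 0, violating ones
  -- `±2S`. For odd `S` this is twice the winding parity allowed by `coeff`; for even `S` it
  -- vanishes. The total is `±2`.
  have hd : (4 : ℤ) ∣ ∑ l, (2 * (if l ∈ G.oddStrange then ∑ j, n l j else 0) -
      if G.src l ∈ G.strangeComponent then
        ((G.srcSign l : ℤ) * 1 + (G.tgtSign l : ℤ) * 1) *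
          Q.strangeness (G.species l) else 0) := by
    refine Finset.dvd_sum fun l _ => ?_
    simp only [mem_oddStrange]
    by_cases hl : G.src l ∈ G.strangeComponent
    · rcases Int.even_or_odd' (Q.strangeness (G.species l)) with ⟨k, hk | hk⟩
      · simp only [hl, hk, Int.not_odd_iff_even.2 (even_two_mul k), if_false, if_true, false_and]
        rcases Int.units_eq_one_or (G.srcSign l) with h1 | h1 <;>
        rcases Int.units_eq_one_or (G.tgtSign l) with h2 | h2 <;>
        simp only [h1, h2, Units.val_neg, Units.val_one] <;> omega
      · rw [if_pos ⟨⟨k, hk⟩, hl⟩, if_pos hl]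
        have hS : Q.flavour (G.species l) strangeQ = 2 * k + 1 := hk
        have hF : Q.flavour (G.species l) ≠ 0 := fun h0 => by
          rw [h0, Pi.zero_apply] at hS; omega
        have hl' := hc l
        rw [coeff, if_neg hF] at hl'
        have hsign : G.srcFlavour l = -G.tgtFlavour l ↔ (G.srcSign l : ℤ) = -G.tgtSign l := by
          constructor
          · intro h0
            have h1 := congrFun h0 strangeQ
            simp only [srcFlavour, tgtFlavour, Pi.neg_apply, ← neg_mul] at h1
            exact mul_right_cancel₀ (by omega) h1
          · intro h0
            ext q
            simp [srcFlavour, tgtFlavour, h0]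
        simp only [hsign] at hl'
        rw [hk]
        generalize ∑ j, n l j = N at hl' ⊢
        rcases Int.units_eq_one_or (G.srcSign l) with h1 | h1 <;>
        rcases Int.units_eq_one_or (G.tgtSign l) with h2 | h2 <;>
        simp [h1, h2] at hl' ⊢ <;> omega
    · simp [hl]
  rw [Finset.sum_sub_distrib, h fun _ => 1, ← Finset.mul_sum, Finset.sum_ite_mem,
    Finset.univ_inter] at hd
  rw [Int.odd_iff]
  rcases Int.units_eq_one_or σ with h1 | h1 <;>
  simp only [h1, Units.val_neg, Units.val_one] at hd <;> omega

/-- Conservation weighted with the indicator of `A`: modulo 2 a line with both ends in `A` counts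
twice and disappears, and signs are immaterial. -/
theorem sum_flavour_crossing_modEq {A : Set V} (h₀ : G.ξ₀ ∈ A) (h₁ : G.ξ₁ ∉ A) (q : Flavour H) :
    ∑ l ∈ G.crossing A, Q.flavour (G.species l) q ≡ Q.flavour Q.xiMinus q [ZMOD 2] := by
  obtain ⟨σ, σ', h⟩ := G.exists_sum_flavour_eq q
  have h2 := h fun a => if a ∈ A then 1 else 0
  have hd : (2 : ℤ) ∣ ∑ l, ((if l ∈ G.crossing A then Q.flavour (G.species l) q else 0) -
      ((G.srcSign l : ℤ) * (if G.src l ∈ A then 1 else 0) +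
        (G.tgtSign l : ℤ) * (if G.tgt l ∈ A then 1 else 0)) * Q.flavour (G.species l) q) := by
    refine Finset.dvd_sum fun l _ => ?_
    simp only [mem_crossing]
    rcases Int.units_eq_one_or (G.srcSign l) with h1 | h1 <;>
    rcases Int.units_eq_one_or (G.tgtSign l) with h2 | h2 <;>
    by_cases h3 : G.src l ∈ A <;> by_cases h4 : G.tgt l ∈ A <;> simp [h1, h2, h3, h4] <;> omega
  rw [Finset.sum_sub_distrib, h2, if_pos h₀, if_neg h₁, Finset.sum_ite_mem,
    Finset.univ_inter] at hd
  rw [Int.modEq_comm, Int.modEq_iff_dvd]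
  rcases Int.units_eq_one_or σ with h1 | h1 <;>
  simp only [h1, Units.val_neg, Units.val_one] at hd <;> omega

theorem even_card_crossing_oddStrange (hG : G.InDs) (A : Set V) :
    Even (G.oddStrange ∩ G.crossing A).card := by
  have h := G.even_sum_oddStrange hG fun a => if a ∈ A then 1 else 0
  have hd : (2 : ℤ) ∣ ∑ l ∈ G.oddStrange, ((if l ∈ G.crossing A then 1 else 0) -
      ((if G.src l ∈ A then 1 else 0) + (if G.tgt l ∈ A then 1 else 0))) := by
    refine Finset.dvd_sum fun l _ => ?_
    simp only [mem_crossing]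
    by_cases h3 : G.src l ∈ A <;> by_cases h4 : G.tgt l ∈ A <;> simp [h3, h4]
  rw [Finset.sum_sub_distrib, Finset.sum_ite_mem, Finset.sum_const, nsmul_one] at hd
  have := (dvd_sub_left h.two_dvd).1 hd
  exact even_iff_two_dvd.2 (by exact_mod_cast this)

/-- A path of strange lines from `ξ₀` to `v` has to leave `A`. -/
theorem exists_isStrange_mem_crossing {A : Set V} (h₀ : G.ξ₀ ∈ A) {v : V}
    (hv : v ∈ G.strangeComponent) (hvA : v ∉ A) :
    ∃ l ∈ G.crossing A, G.IsStrange l ∧ G.src l ∈ G.strangeComponent := by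
  by_contra! hno
  rw [mem_strangeComponent] at hv
  refine hvA ?_
  induction hv with
  | refl => exact h₀
  | tail hb hbc ih =>
    obtain ⟨l, hl, hbc⟩ := hbc
    have hb' := G.mem_strangeComponent.2 hb
    have hsrc : G.src l ∈ G.strangeComponent := by
      rcases hbc with ⟨rfl, rfl⟩ | ⟨rfl, rfl⟩
      · exact hb'
      · exact (G.src_mem_strangeComponent_iff hl).2 hb'
    have hcross : G.src l ∈ A ↔ G.tgt l ∈ A := by
      by_contra h
      exact hno l (G.mem_crossing.2 h) hl hsrc
    rcases hbc with ⟨rfl, rfl⟩ | ⟨rfl, rfl⟩ <;> tauto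

/-- The mass of a line, reduced on the odd-strangeness lines of the component of `ξ₀`. -/
def reducedMass (r : ℝ) (l : L) : ℝ :=
  if l ∈ G.oddStrange then √(G.lineMass l ^ 2 - r ^ 2) else G.lineMass l

theorem reducedMass_nonneg (r : ℝ) (l : L) : 0 ≤ G.reducedMass r l := by
  unfold reducedMass
  split_ifs
  exacts [Real.sqrt_nonneg _, (Q.mass_pos _).le]

theorem add_le_sum_reducedMass (r : ℝ) (X : Finset L) {l l' : L} (hl : l ∈ X) (hl' : l' ∈ X)
    (h : l ≠ l') : G.reducedMass r l + G.reducedMass r l' ≤ ∑ k ∈ X, G.reducedMass r k := by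
  rw [← Finset.sum_pair h]
  exact Finset.sum_le_sum_of_subset_of_nonneg (by simp [Finset.insert_subset_iff, hl, hl'])
    fun k _ _ => G.reducedMass_nonneg r k

theorem exists_odd_baryonNumber_mem_crossing {A : Set V} (h₀ : G.ξ₀ ∈ A) (h₁ : G.ξ₁ ∉ A) :
    ∃ l ∈ G.crossing A, Odd (Q.baryonNumber (G.species l)) := by
  by_contra! hno
  simp only [Spectrum.odd_baryonNumber_iff, Int.not_odd_iff_even] at hno
  have h1 : Even (∑ l ∈ G.crossing A, ∑ q, Q.flavour (G.species l) q) := by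
    rw [even_iff_two_dvd]
    exact Finset.dvd_sum fun l hl => (hno l hl).two_dvd
  have h2 : (2 : ℤ) ∣ ∑ q, (∑ l ∈ G.crossing A, Q.flavour (G.species l) q -
      Q.flavour Q.xiMinus q) :=
    Finset.dvd_sum fun q _ =>
      Int.modEq_iff_dvd.1 (G.sum_flavour_crossing_modEq h₀ h₁ q).symm
  rw [Finset.sum_sub_distrib, Finset.sum_comm] at h2
  exact Int.not_even_iff_odd.2 Q.odd_sum_flavour_xiMinus
    (even_iff_two_dvd.2 ((dvd_sub_right h1.two_dvd).1 h2))

/-- The lines that cross any cut between `ξ₀` and a vertex of its strange component have total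
reduced mass at least `E`. -/
theorem le_sum_reducedMass_crossing (hQ : Q.PhysicalMasses) (hG : G.InDs) {E r : ℝ}
    (hE : E ≤ Q.mass Q.xiMinus)
    (hE₁ : E ≤ √(Q.mass Q.lambda ^ 2 - r ^ 2) + √(Q.mass Q.kaon ^ 2 - r ^ 2))
    (hE₂ : E ≤ 2 * √(Q.mass Q.kaon ^ 2 - r ^ 2) + Q.mass Q.proton)
    {A : Set V} (h₀ : G.ξ₀ ∈ A) (h₁ : G.ξ₁ ∉ A) {v : V}
    (hv : v ∈ G.strangeComponent) (hvA : v ∉ A) :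
    E ≤ ∑ l ∈ G.crossing A, G.reducedMass r l := by
  have hmono : ∀ X l, l ∈ G.oddStrange → Q.mass X ≤ G.lineMass l →
      √(Q.mass X ^ 2 - r ^ 2) ≤ G.reducedMass r l := by
    intro X l hl hX
    rw [reducedMass, if_pos hl]
    have := (Q.mass_pos X).le
    gcongr
  have hfull : ∀ l, l ∉ G.oddStrange → G.reducedMass r l = Q.mass (G.species l) :=
    fun l hl => if_neg hl
  have hkaon : ∀ l ∈ G.oddStrange, √(Q.mass Q.kaon ^ 2 - r ^ 2) ≤ G.reducedMass r l :=
    fun l hl => hmono _ l hl (hQ.kaon_le _ (G.isStrange_iff.1 (G.isStrange_of_mem_oddStrange hl)))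
  obtain ⟨lB, hlB, hB⟩ := G.exists_odd_baryonNumber_mem_crossing h₀ h₁
  by_cases hne : (G.oddStrange ∩ G.crossing A).Nonempty
  -- A cycle modulo 2 crosses a cut an even number of times, so never just once.
  · have hpair : ∀ l ∈ G.oddStrange ∩ G.crossing A, ∃ l' ∈ G.oddStrange ∩ G.crossing A,
        l' ≠ l := by
      intro l hl
      refine Finset.exists_mem_ne ?_ l
      obtain ⟨k, hk⟩ := G.even_card_crossing_oddStrange hG A
      have := Finset.card_pos.2 ⟨l, hl⟩
      omega
    by_cases hodd : ∃ l ∈ G.oddStrange ∩ G.crossing A, Odd (Q.baryonNumber (G.species l))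
    · obtain ⟨l, hl, hlodd⟩ := hodd
      obtain ⟨l', hl', hne'⟩ := hpair l hl
      rw [Finset.mem_inter] at hl hl'
      have h2 := hmono Q.lambda l hl.1 (hQ.lambda_le _
        (G.isStrange_iff.1 (G.isStrange_of_mem_oddStrange hl.1)) hlodd)
      linarith [hkaon l' hl'.1, G.add_le_sum_reducedMass r _ hl.2 hl'.2 hne'.symm]
    -- The odd baryon number is carried by a third line, of unreduced mass: K, K and p.
    · push Not at hodd
      obtain ⟨l, hl⟩ := hne
      obtain ⟨l', hl', hne'⟩ := hpair l hl
      have hlB' : lB ∉ G.oddStrange := fun h =>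
        hodd lB (Finset.mem_inter.2 ⟨h, hlB⟩) hB
      rw [Finset.mem_inter] at hl hl'
      have h3 : G.reducedMass r lB + (G.reducedMass r l + G.reducedMass r l') ≤
          ∑ k ∈ G.crossing A, G.reducedMass r k := by
        rw [← Finset.add_sum_erase _ _ hlB]
        gcongr
        exact G.add_le_sum_reducedMass r _
          (Finset.mem_erase.2 ⟨fun h => hlB' (h ▸ hl.1), hl.2⟩)
          (Finset.mem_erase.2 ⟨fun h => hlB' (h ▸ hl'.1), hl'.2⟩) hne'.symm
      rw [hfull lB hlB'] at h3
      linarith [hkaon l hl.1, hkaon l' hl'.1, hQ.proton_le _ hB]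
  -- No crossing mass is reduced, and a line of nonzero even strangeness crosses. It has the
  -- parities of Ξ⁻, or it is at least as heavy as Ξ⁰ and another flavoured line crosses, or its
  -- baryon number is even and a line of odd baryon number crosses too.
  · rw [Finset.not_nonempty_iff_eq_empty, ← Finset.disjoint_iff_inter_eq_empty] at hne
    have hfull' : ∀ l ∈ G.crossing A, G.reducedMass r l = Q.mass (G.species l) :=
      fun l hl => hfull l (Finset.disjoint_right.1 hne hl)
    obtain ⟨l, hl, hls, hlc⟩ := G.exists_isStrange_mem_crossing h₀ hv hvA
    have heven : Even (Q.strangeness (G.species l)) := by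
      rw [← Int.not_odd_iff_even]
      exact fun h => Finset.disjoint_right.1 hne hl (G.mem_oddStrange.2 ⟨h, hlc⟩)
    rw [isStrange_iff] at hls
    by_cases hBl : Odd (Q.baryonNumber (G.species l))
    · by_cases hXi : ∀ q, Q.flavour (G.species l) q ≡ Q.flavour Q.xiMinus q [ZMOD 2]
      · have h2 := Finset.single_le_sum (fun k _ => G.reducedMass_nonneg r k) hl
        rw [hfull' l hl] at h2
        linarith [hQ.xiMinus_le _ hls hXi]
      · push Not at hXi
        obtain ⟨q, hq⟩ := hXi
        obtain ⟨l', hl', hne', hF⟩ : ∃ l' ∈ G.crossing A, l' ≠ l ∧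
            Q.flavour (G.species l') ≠ 0 := by
          by_contra! hno
          refine hq ?_
          rw [← Finset.sum_eq_single_of_mem (f := fun k => Q.flavour (G.species k) q) l hl
            fun k hk hkl => by simp [hno k hk hkl]]
          exact G.sum_flavour_crossing_modEq h₀ h₁ q
        have h2 := G.add_le_sum_reducedMass r _ hl hl' hne'.symm
        rw [hfull' l hl, hfull' l' hl'] at h2
        linarith [hQ.xiZero_le _ hls heven hBl, hQ.pion_le _ hF, hQ.xiMinus_le_xiZero_pion]
    · have h2 := G.add_le_sum_reducedMass r _ hl hlB fun h => hBl (h ▸ hB)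
      rw [hfull' l hl, hfull' lB hlB] at h2
      linarith [hQ.kaon_le _ hls, hQ.proton_le _ hB, hQ.xiMinus_le_proton_kaon]

end Diagram

/-! ### Lower bound on the action -/

namespace Diagram

variable {H P V L : Type*} [Fintype H] [Fintype V] [Fintype L] {Q : Spectrum H P}
  (G : Diagram Q V L)

theorem lastVertex_mem_strangeComponent (τ : TimeOrdering V) :
    G.lastVertex τ ∈ G.strangeComponent := by
  obtain ⟨a, ha, h⟩ := Finset.mem_image.1 (Finset.max'_mem (G.strangeComponent.image τ)
    (Finset.image_nonempty.2 ⟨_, G.ext_mem_strangeComponent⟩))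
  rw [lastVertex, ← h, Equiv.symm_apply_apply]
  exact ha

theorem le_lastVertex (τ : TimeOrdering V) {a : V} (ha : a ∈ G.strangeComponent) :
    τ a ≤ τ (G.lastVertex τ) := by
  simp only [lastVertex, Equiv.apply_symm_apply]
  exact Finset.le_max' _ _ (Finset.mem_image_of_mem _ ha)

variable (τ : TimeOrdering V) (x : G.PastVertex τ → Spacetime)

/-- The times of the vertices, where those after `v₋` are moved to the time of `v₋`. -/
def truncTime (a : V) : ℝ :=
  if h : τ a ≤ τ (G.lastVertex τ) then x ⟨a, h⟩ 0 else x (G.pastLast τ) 0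

/-- A spatial coordinate of the vertices of `G₋`, extended by zero. -/
def spaceCoord (j : Fin 3) (a : V) : ℝ :=
  if h : τ a ≤ τ (G.lastVertex τ) then x ⟨a, h⟩ j.succ else 0

variable {τ x}

theorem time_le_time_last (hx : x ∈ G.domain τ) (a : G.PastVertex τ) :
    x a 0 ≤ x (G.pastLast τ) 0 := by
  rcases a.2.lt_or_eq with h | h
  · exact hx.1 a (G.pastLast τ) h
  · rw [show a = G.pastLast τ from Subtype.ext (τ.injective h)]

theorem time_last_nonneg (hx : x ∈ G.domain τ) : 0 ≤ x (G.pastLast τ) 0 := by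
  simpa [hx.2] using G.time_le_time_last hx (G.pastExt τ)

/-- The contribution of a line to the action, bounded below by a multiple of its temporal extent
and, for an odd-strangeness line in the component of `ξ₀`, of its spatial extent. -/
theorem line_bound_past {r : ℝ} (hr : 0 ≤ r) (hrK : r ≤ Q.mass Q.kaon) (hQ : Q.PhysicalMasses)
    (n : L → Fin 3 → ℤ) (j : Fin 3) (l : G.PastLine τ) :
    G.reducedMass r l.1 * |G.truncTime τ x (G.tgt l.1) - G.truncTime τ x (G.src l.1)| +
      (if l.1 ∈ G.oddStrange then
        r * |G.spaceCoord τ x j (G.tgt l.1) - G.spaceCoord τ x j (G.src l.1) + n l.1 j| else 0) ≤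
    G.lineMass l.1 * ‖x ⟨G.tgt l.1, l.2.2⟩ - x ⟨G.src l.1, l.2.1⟩ + windingVec (n l.1)‖ := by
  simp only [truncTime, spaceCoord, dif_pos l.2.1, dif_pos l.2.2]
  set y := x ⟨G.tgt l.1, l.2.2⟩ - x ⟨G.src l.1, l.2.1⟩ + windingVec (n l.1) with hy
  have h0 : x ⟨G.tgt l.1, l.2.2⟩ 0 - x ⟨G.src l.1, l.2.1⟩ 0 = y 0 := by
    simp [hy, windingVec]
  have hj : x ⟨G.tgt l.1, l.2.2⟩ j.succ - x ⟨G.src l.1, l.2.1⟩ j.succ + n l.1 j = y j.succ := by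
    simp [hy, windingVec]
  rw [h0, hj, reducedMass]
  split_ifs with hl
  · exact calibration_le_mul_norm hr (hrK.trans (hQ.kaon_le _
      (G.isStrange_iff.1 (G.isStrange_of_mem_oddStrange hl)))) y j
  · rw [add_zero]
    exact mul_le_mul_of_nonneg_left (PiLp.norm_apply_le y 0) (Q.mass_pos _).le

/-- The component of `ξ₀` lies in `G₋`, so its lines are never cut. Truncation at the time of `v₋`
gives a cut line exactly the temporal extent occurring in the action, and its energy is at least its
mass. -/
theorem line_bound_cut (hx : x ∈ G.domain τ) {r : ℝ} (k : ℝ) (l : G.CutLine τ) :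
    l.1 ∉ G.oddStrange ∧
    G.reducedMass r l.1 * |G.truncTime τ x (G.tgt l.1) - G.truncTime τ x (G.src l.1)| ≤
    √(G.lineMass l.1 ^ 2 + k ^ 2) * (x (G.pastLast τ) 0 - x (G.cutInner τ l) 0) := by
  have hl : l.1 ∉ G.oddStrange := fun h => by
    have h1 := G.le_lastVertex τ (G.mem_oddStrange.1 h).2
    have h2 := G.le_lastVertex τ (G.tgt_mem_of_mem_oddStrange h)
    exact l.2.elim (fun h' => h'.2 h2) (fun h' => h'.2 h1)
  have ht : |G.truncTime τ x (G.tgt l.1) - G.truncTime τ x (G.src l.1)| =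
      x (G.pastLast τ) 0 - x (G.cutInner τ l) 0 := by
    have h0 := sub_nonneg.2 (G.time_le_time_last hx (G.cutInner τ l))
    rcases l.2 with ⟨h1, h2⟩ | ⟨h2, h1⟩
    · simp only [truncTime, cutInner, dif_pos h1, dif_neg h2] at h0 ⊢
      exact abs_of_nonneg h0
    · simp only [truncTime, cutInner, dif_pos h2, dif_neg h1] at h0 ⊢
      rw [abs_sub_comm]
      exact abs_of_nonneg h0
  refine ⟨hl, ?_⟩
  rw [ht, reducedMass, if_neg hl]
  refine mul_le_mul_of_nonneg_right (Real.le_sqrt_of_sq_le ?_)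
    (sub_nonneg.2 (G.time_le_time_last hx _))
  nlinarith [sq_nonneg k]

theorem sum_lines_le_action (hx : x ∈ G.domain τ) (hQ : Q.PhysicalMasses)
    {r : ℝ} (hr : 0 ≤ r) (hrK : r ≤ Q.mass Q.kaon) (E : ℝ)
    (p : G.CutLine τ → EuclideanSpace ℝ (Fin 3)) (n : L → Fin 3 → ℤ) (j : Fin 3) :
    -E * x (G.pastLast τ) 0 +
      (∑ l, G.reducedMass r l * |G.truncTime τ x (G.tgt l) - G.truncTime τ x (G.src l)| +
      r * ∑ l ∈ G.oddStrange,
        |G.spaceCoord τ x j (G.tgt l) - G.spaceCoord τ x j (G.src l) + n l j|) ≤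
    G.action τ E p n x := by
  set T : L → ℝ := fun l =>
    G.reducedMass r l * |G.truncTime τ x (G.tgt l) - G.truncTime τ x (G.src l)| +
      (if l ∈ G.oddStrange then
        r * |G.spaceCoord τ x j (G.tgt l) - G.spaceCoord τ x j (G.src l) + n l j| else 0) with hT
  have h1 : ∑ l, G.reducedMass r l * |G.truncTime τ x (G.tgt l) - G.truncTime τ x (G.src l)| +
      r * ∑ l ∈ G.oddStrange,
        |G.spaceCoord τ x j (G.tgt l) - G.spaceCoord τ x j (G.src l) + n l j| = ∑ l, T l := by
    rw [Finset.sum_add_distrib, Finset.sum_ite_mem, Finset.univ_inter, Finset.mul_sum]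
  have h2 : ∑ l, T l = ∑ l : G.CutLine τ, T l.1 + ∑ l : G.PastLine τ, T l.1 := by
    rw [← Finset.sum_subtype (Finset.univ.filter fun l =>
        Xor (τ (G.src l) ≤ τ (G.lastVertex τ)) (τ (G.tgt l) ≤ τ (G.lastVertex τ)))
        (by simp) T,
      ← Finset.sum_subtype (Finset.univ.filter fun l =>
        τ (G.src l) ≤ τ (G.lastVertex τ) ∧ τ (G.tgt l) ≤ τ (G.lastVertex τ)) (by simp) T,
      Finset.sum_filter, Finset.sum_filter, ← Finset.sum_add_distrib]
    refine Finset.sum_congr rfl fun l _ => ?_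
    by_cases hs : τ (G.src l) ≤ τ (G.lastVertex τ) <;>
    by_cases ht : τ (G.tgt l) ≤ τ (G.lastVertex τ)
    · simp [hs, ht]
    · simp [hs, ht]
    · simp [hs, ht]
    -- Both ends are truncated to the time of `v₋`, so the line contributes nothing.
    · have hl : l ∉ G.oddStrange := fun h => hs (G.le_lastVertex τ (G.mem_oddStrange.1 h).2)
      simp [hs, ht, hT, hl, truncTime]
  rw [h1, h2, action, add_assoc]
  gcongr with l _ l _
  · obtain ⟨hl, hle⟩ := G.line_bound_cut hx (r := r) ‖p l‖ l
    simpa [hT, hl] using hle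
  · exact G.line_bound_past hr hrK hQ n j l

theorem le_action (hQ : Q.PhysicalMasses) (hG : G.InDs) {n : L → Fin 3 → ℤ}
    (hn : G.Contributes n) (hτ : G.InTs τ) (hx : x ∈ G.domain τ)
    (p : G.CutLine τ → EuclideanSpace ℝ (Fin 3)) {E r : ℝ}
    (hr : 0 ≤ r) (hrK : r ≤ Q.mass Q.kaon) (hE : E ≤ Q.mass Q.xiMinus)
    (hE₁ : E ≤ √(Q.mass Q.lambda ^ 2 - r ^ 2) + √(Q.mass Q.kaon ^ 2 - r ^ 2))
    (hE₂ : E ≤ 2 * √(Q.mass Q.kaon ^ 2 - r ^ 2) + Q.mass Q.proton) :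
    r ≤ G.action τ E p n x := by
  obtain ⟨j, hj⟩ : ∃ j, Odd (∑ l ∈ G.oddStrange, n l j) := by
    by_contra! hno
    refine Int.not_even_iff_odd.2 (G.odd_sum_winding hG hn) ?_
    rw [Finset.sum_comm, even_iff_two_dvd]
    exact Finset.dvd_sum fun j _ => (Int.not_odd_iff_even.1 (hno j)).two_dvd
  have hspace := one_le_sum_abs_of_odd_winding G.oddStrange G.src G.tgt (G.even_sum_oddStrange hG)
    (fun l => n l j) hj (G.spaceCoord τ x j)
  have htime := mul_le_sum_weight_mul_length (G.reducedMass r)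
    (fun l => G.truncTime τ x (G.src l)) (fun l => G.truncTime τ x (G.tgt l))
    (G.reducedMass_nonneg r) (E := E) (G.time_last_nonneg hx) fun t ht => by
      have h0 : G.truncTime τ x G.ξ₀ = 0 := by
        rw [truncTime, dif_pos (G.ext_le_lastVertex τ)]
        exact congrArg (fun y : Spacetime => y 0) hx.2
      have h1 : G.truncTime τ x G.ξ₁ = x (G.pastLast τ) 0 :=
        dif_neg (not_le.2 (hτ _ (G.lastVertex_mem_strangeComponent τ)))
      have hv : G.truncTime τ x (G.lastVertex τ) = x (G.pastLast τ) 0 := by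
        rw [truncTime, dif_pos le_rfl, pastLast]
      -- The cut at time `t` has `ξ₀` before it, and `v₋` and the truncated `ξ₁` not before it. Its
      -- crossing lines are those whose half-open time interval contains `t`.
      refine (G.le_sum_reducedMass_crossing hQ hG hE hE₁ hE₂
        (A := {a | G.truncTime τ x a < t}) (by simpa [h0] using ht.1) (by simpa [h1] using ht.2)
        (G.lastVertex_mem_strangeComponent τ) (by simpa [hv] using ht.2)).trans_eq ?_
      rw [crossing, Finset.sum_filter]
      refine Finset.sum_congr rfl fun l _ => if_congr ?_ rfl rfl
      simp only [Set.mem_ofPred_eq, Set.mem_uIoc]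
      grind
  have := G.sum_lines_le_action hx hQ hr hrK E p n j
  nlinarith

theorem zero_mem_domain (τ : TimeOrdering V) : (0 : G.PastVertex τ → Spacetime) ∈ G.domain τ :=
  ⟨fun _ _ _ => le_rfl, rfl⟩

end Diagram

end FlavourMixing

end

theorem mainTheorem3 {H P V L : Type*} [Fintype H] [Fintype V] [Fintype L]
    (Q : FlavourMixing.Spectrum H P) (hQ : Q.PhysicalMasses)
    (G : FlavourMixing.Diagram Q V L) (hG : G.InDs)
    (n : L → Fin 3 → ℤ) (hn : G.Contributes n)
    (τ : FlavourMixing.Diagram.TimeOrdering V) (hτ : G.InTs τ)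
    (p : G.CutLine τ → EuclideanSpace ℝ (Fin 3))
    (E : ℝ) (hE₀ : 0 < E) (hE : E < Q.mass Q.xiMinus) :
    (G.domain τ).Nonempty ∧
    BddBelow (G.action τ E p n '' G.domain τ) ∧
    FlavourMixing.massBound (Q.mass Q.kaon) (Q.mass Q.proton) (Q.mass Q.lambda) E
      ≤ G.exponent τ E p n := by
  obtain ⟨h0, hK, h1, h2⟩ := FlavourMixing.massBound_spec (Q.mass_pos Q.kaon) (Q.mass_pos Q.proton)
    (Q.mass_pos Q.lambda) hE₀ (hE.le.trans hQ.xiMinus_le_proton_kaon) hQ.proton_kaon_lambda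
  have hne : (G.domain τ).Nonempty := ⟨0, G.zero_mem_domain τ⟩
  have hle : ∀ s ∈ G.action τ E p n '' G.domain τ,
      FlavourMixing.massBound (Q.mass Q.kaon) (Q.mass Q.proton) (Q.mass Q.lambda) E ≤ s := by
    rintro _ ⟨x, hx, rfl⟩
    exact G.le_action hQ hG hn hτ hx p h0 hK hE.le h1 h2
  exact ⟨hne, ⟨_, hle⟩, le_csInf (hne.image _) hle⟩
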